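/- Let $K$ be a field of characteristic different from $2$, let $\Gamma=(\Gamma_0,\Gamma_1)$ be a finite quiver without oriented cycles (no path of length $\geq 1$ ends at the vertex where it starts), and let $\rho$ be a set of relations on $\Gamma$, i.e. of $K$-linear combinations of paths of length at least $2$ with a common start and a common end. In the path algebra $K\Gamma$ the product $xy$ of two paths is the path "first $y$, then $x$" if $y$ ends where $x$ starts, and $0$ otherwise. Let $\Lambda=K(\Gamma,\rho)=K\Gamma/\langle\rho\rangle$. Let $\Gamma_1^*$ consist of a reverse arrow $\alpha^*:j\to i$ for each arrow $\alpha:i\to j$ in $\Gamma_1$; for a path $p=\alpha_n\cdots\alpha_1$ of $\Gamma$ put $p^*=\alpha_1^*\cdots\alpha_n^*$ (with $e_i^*=e_i$ for trivial paths), extend $*$ linearly to $K\Gamma$, and let $\rho^*=\{\sigma^*:\sigma\in\rho\}$. The dual extension $\mathscr{D}(\Lambda)$ is the path algebra of the quiver $(\Gamma_0,\Gamma_1\cup\Gamma_1^*)$ modulo the ideal generated by $\rho\cup\rho^*\cup\{\alpha\beta^*:\alpha,\beta\in\Gamma_1\}$; elements of $\Lambda$ are regarded as elements of $\mathscr{D}(\Lambda)$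 through the natural algebra homomorphism $\Lambda\to\mathscr{D}(\Lambda)$. Let $\Theta:\mathscr{D}(\Lambda)\to\mathscr{D}(\Lambda)$ be a Lie derivation, i.e. a $K$-linear map with $\Theta([a,b])=[\Theta(a),b]+[a,\Theta(b)]$ for all $a,b$, where $[a,b]=ab-ba$. Then there is a derivation $D$ of $\mathscr{D}(\Lambda)$, i.e. a $K$-linear map with $D(ab)=D(a)b+aD(b)$ for all $a,b$, such that $\Theta(x)=D(x)$ for every $x=\sum_i k_ip_i\in\Lambda$ with $k_i\in K$ and $p_i$ nontrivial paths (paths of length $\geq 1$) of $\Gamma$; moreover, the same $D$ satisfies $\Theta(y)=D(y)$ for every linear combination $y\in\mathscr{D}(\Lambda)$ of nontrivial paths of $(\Gamma_0,\Gamma_1\cup\Gamma_1^*)$. -/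

import Mathlib

universe u v w

noncomputable section

open Quiver

/-- The set of all paths (of any length, with any end points) of a quiver. The element `⟨a, b, p⟩`
is a path `p` with start `s(p) = a` and end `e(p) = b`. -/
abbrev QuiverPath (V : Type v) [Quiver.{w + 1} V] : Type (max v (w + 1)) :=
  Σ a b : V, Path a b

namespace QuiverPath

variable {V : Type v} [Quiver.{w + 1} V]

/-- The number of arrows of a path. -/
def length (p : QuiverPath V) : ℕ := p.2.2.length

/-- A path is nontrivial if it consists of at least one arrow. -/
def IsNontrivial (p : QuiverPath V) : Prop := 1 ≤ p.length

end QuiverPath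

/-- A quiver has no oriented cycles if no nontrivial path ends where it starts. -/
def HasNoOrientedCycles (V : Type v) [Quiver.{w + 1} V] : Prop :=
  ∀ (a : V) (p : Path a a), p.length = 0

/-- The underlying vector space of the path algebra `KΓ`: finitely supported functions on the set
of paths, i.e. formal `K`-linear combinations of paths. -/
def PathAlgebra (K : Type u) [Field K] (V : Type v) [Quiver.{w + 1} V] : Type (max u v (w + 1)) :=
  QuiverPath V →₀ K

namespace PathAlgebra

variable {K : Type u} [Field K] {V : Type v} [Quiver.{w + 1} V]

instance : AddCommGroup (PathAlgebra K V) := inferInstanceAs (AddCommGroup (QuiverPath V →₀ K))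

instance : Module K (PathAlgebra K V) := inferInstanceAs (Module K (QuiverPath V →₀ K))

variable (K) in
/-- A path, seen as a basis element of the path algebra. -/
def ofPath (p : QuiverPath V) : PathAlgebra K V := Finsupp.single p 1

variable (K V) in
/-- The basis of the path algebra that consists of the paths. -/
def basis : Module.Basis (QuiverPath V) K (PathAlgebra K V) :=
  Module.Basis.ofRepr (LinearEquiv.refl K (QuiverPath V →₀ K))

@[simp]
theorem basis_apply (p : QuiverPath V) : basis K V p = ofPath K p := rfl

open Classical in
variable (K) in
/-- The product `x y` of two paths: it is "first `y`, then `x`" if `e(y) = s(x)`, and `0`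
otherwise. -/
def pathMul (x y : QuiverPath V) : PathAlgebra K V :=
  if h : y.2.1 = x.1 then ofPath K ⟨y.1, x.2.1, y.2.2.comp (x.2.2.cast h.symm rfl)⟩ else 0

theorem pathMul_comp {a b c : V} (p : Path b c) (q : Path a b) :
    pathMul K ⟨b, c, p⟩ ⟨a, b, q⟩ = ofPath K ⟨a, c, q.comp p⟩ := by
  simp [pathMul]

theorem pathMul_of_ne {x y : QuiverPath V} (h : y.2.1 ≠ x.1) : pathMul K x y = 0 := by
  simp [pathMul, h]

variable (K V) in
/-- The bilinear extension of the product of paths. -/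
def mulLin : PathAlgebra K V →ₗ[K] PathAlgebra K V →ₗ[K] PathAlgebra K V :=
  (basis K V).constr K fun x => (basis K V).constr K fun y => pathMul K x y

instance : Mul (PathAlgebra K V) := ⟨fun x y => mulLin K V x y⟩

theorem mul_eq_mulLin (x y : PathAlgebra K V) : x * y = mulLin K V x y := rfl

theorem ofPath_mul_ofPath (x y : QuiverPath V) :
    ofPath K x * ofPath K y = pathMul K x y := by
  rw [mul_eq_mulLin, mulLin, ← basis_apply, ← basis_apply, Module.Basis.constr_basis,
    Module.Basis.constr_basis]

/-- The trivial path `e_i` at the vertex `i`. -/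
def idem (K : Type u) [Field K] {V : Type v} [Quiver.{w + 1} V] (i : V) : PathAlgebra K V :=
  ofPath K ⟨i, i, Path.nil⟩

/-- The identity of the path algebra of a finite quiver is the sum of the trivial paths. -/
instance [Fintype V] : One (PathAlgebra K V) := ⟨∑ i : V, idem K i⟩

theorem one_def [Fintype V] : (1 : PathAlgebra K V) = ∑ i : V, idem K i := rfl

theorem induction_on {P : PathAlgebra K V → Prop} (x : PathAlgebra K V) (h0 : P 0)
    (hadd : ∀ x y, P x → P y → P (x + y)) (hsmul : ∀ (k : K) (p : QuiverPath V),
      P (k • ofPath K p)) : P x := by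
  have hx : x ∈ Submodule.span K (Set.range (basis K V)) := by
    rw [(basis K V).span_eq]; trivial
  have key : ∀ k : K, P (k • x) := by
    induction hx using Submodule.span_induction with
    | mem y hy => obtain ⟨p, rfl⟩ := hy; exact fun k => hsmul k p
    | zero => intro k; simpa using h0
    | add y z _ _ hy hz => intro k; rw [smul_add]; exact hadd _ _ (hy k) (hz k)
    | smul c y _ hy => intro k; rw [smul_smul]; exact hy _
  simpa using key 1

theorem add_mul' (x y z : PathAlgebra K V) : (x + y) * z = x * z + y * z := by
  simp [mul_eq_mulLin]

theorem mul_add' (x y z : PathAlgebra K V) : x * (y + z) = x * y + x * z := by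
  simp [mul_eq_mulLin]

theorem smul_mul' (k : K) (x y : PathAlgebra K V) : (k • x) * y = k • (x * y) := by
  simp [mul_eq_mulLin]

theorem mul_smul' (k : K) (x y : PathAlgebra K V) : x * (k • y) = k • (x * y) := by
  simp [mul_eq_mulLin]

theorem zero_mul' (x : PathAlgebra K V) : 0 * x = 0 := by simp [mul_eq_mulLin]

theorem mul_zero' (x : PathAlgebra K V) : x * 0 = 0 := by simp [mul_eq_mulLin]

theorem ofPath_mul_assoc (x y z : QuiverPath V) :
    ofPath K x * ofPath K y * ofPath K z = ofPath K x * (ofPath K y * ofPath K z) := by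
  obtain ⟨x₁, x₂, p⟩ := x
  obtain ⟨y₁, y₂, q⟩ := y
  obtain ⟨z₁, z₂, r⟩ := z
  rw [ofPath_mul_ofPath, ofPath_mul_ofPath]
  by_cases h : y₂ = x₁
  · subst h
    rw [pathMul_comp, ofPath_mul_ofPath]
    by_cases h' : z₂ = y₁
    · subst h'
      rw [pathMul_comp, pathMul_comp, ofPath_mul_ofPath, pathMul_comp, Path.comp_assoc]
    · rw [pathMul_of_ne (by exact h'), pathMul_of_ne (by exact h'), mul_zero']
  · rw [pathMul_of_ne (by exact h), zero_mul']
    by_cases h' : z₂ = y₁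
    · subst h'
      rw [pathMul_comp, ofPath_mul_ofPath, pathMul_of_ne (by exact h)]
    · rw [pathMul_of_ne (by exact h'), mul_zero']

theorem mul_assoc' (x y z : PathAlgebra K V) : x * y * z = x * (y * z) := by
  induction x using induction_on with
  | h0 => simp only [zero_mul']
  | hadd x x' hx hx' => simp only [add_mul', hx, hx']
  | hsmul k p =>
    induction y using induction_on with
    | h0 => simp only [zero_mul', mul_zero']
    | hadd y y' hy hy' => simp only [add_mul', mul_add', hy, hy']
    | hsmul l q =>
      induction z using induction_on with
      | h0 => simp only [mul_zero']
      | hadd z z' hz hz' => simp only [mul_add', hz, hz']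
      | hsmul m r => simp only [smul_mul', mul_smul', ofPath_mul_assoc]

theorem sum_mul' {ι : Type*} (s : Finset ι) (f : ι → PathAlgebra K V) (x : PathAlgebra K V) :
    (∑ i ∈ s, f i) * x = ∑ i ∈ s, f i * x := by
  simp [mul_eq_mulLin, map_sum, LinearMap.sum_apply]

theorem mul_sum' {ι : Type*} (s : Finset ι) (f : ι → PathAlgebra K V) (x : PathAlgebra K V) :
    x * (∑ i ∈ s, f i) = ∑ i ∈ s, x * f i := by
  simp [mul_eq_mulLin, map_sum]

theorem one_mul' [Fintype V] (x : PathAlgebra K V) : 1 * x = x := by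
  induction x using induction_on with
  | h0 => rw [mul_zero']
  | hadd x y hx hy => rw [mul_add', hx, hy]
  | hsmul k p =>
    obtain ⟨a, b, p⟩ := p
    rw [mul_smul', one_def, sum_mul', Finset.sum_eq_single b]
    · rw [idem, ofPath_mul_ofPath, pathMul_comp, Path.comp_nil]
    · intro i _ hi
      rw [idem, ofPath_mul_ofPath, pathMul_of_ne (by exact hi.symm)]
    · intro h; exact absurd (Finset.mem_univ b) h

theorem mul_one' [Fintype V] (x : PathAlgebra K V) : x * 1 = x := by
  induction x using induction_on with
  | h0 => rw [zero_mul']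
  | hadd x y hx hy => rw [add_mul', hx, hy]
  | hsmul k p =>
    obtain ⟨a, b, p⟩ := p
    rw [smul_mul', one_def, mul_sum', Finset.sum_eq_single a]
    · rw [idem, ofPath_mul_ofPath, pathMul_comp, Path.nil_comp]
    · intro i _ hi
      rw [idem, ofPath_mul_ofPath, pathMul_of_ne (by exact hi)]
    · intro h; exact absurd (Finset.mem_univ a) h

instance [Fintype V] : Ring (PathAlgebra K V) where
  __ := (inferInstance : AddCommGroup (PathAlgebra K V))
  mul := (· * ·)
  one := 1
  left_distrib := mul_add'
  right_distrib := add_mul'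
  zero_mul := zero_mul'
  mul_zero := mul_zero'
  mul_assoc := mul_assoc'
  one_mul := one_mul'
  mul_one := mul_one'

instance [Fintype V] : Algebra K (PathAlgebra K V) :=
  Algebra.ofModule smul_mul' (fun k x y => mul_smul' k x y)

/-- A relation on the quiver: a linear combination of paths of length at least two that all have
the same start and the same end. -/
def IsRelation (σ : PathAlgebra K V) : Prop :=
  ∃ a b : V, σ ∈ Submodule.span K
    {x | ∃ p : Path a b, 2 ≤ p.length ∧ x = ofPath K (⟨a, b, p⟩ : QuiverPath V)}

end PathAlgebra

section Quotient

variable {K : Type u} [Field K] {V : Type v} [Quiver.{w + 1} V] [Fintype V]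

/-- The algebra `K(Γ, ρ)`: the quotient of the path algebra `KΓ` by the two-sided ideal generated
by `ρ`. -/
def BoundPathAlgebra (ρ : Set (PathAlgebra K V)) : Type (max u v (w + 1)) :=
  (TwoSidedIdeal.span ρ).ringCon.Quotient

namespace BoundPathAlgebra

variable (ρ : Set (PathAlgebra K V))

instance : Ring (BoundPathAlgebra ρ) :=
  inferInstanceAs (Ring (TwoSidedIdeal.span ρ).ringCon.Quotient)

instance : Algebra K (BoundPathAlgebra ρ) :=
  inferInstanceAs (Algebra K (TwoSidedIdeal.span ρ).ringCon.Quotient)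

/-- The quotient map from `KΓ` to `K(Γ, ρ)`. -/
def mk : PathAlgebra K V →ₐ[K] BoundPathAlgebra ρ where
  toRingHom := (TwoSidedIdeal.span ρ).ringCon.mk'
  commutes' _ := rfl

theorem mk_surjective : Function.Surjective (mk ρ) :=
  RingCon.mk'_surjective _

theorem mk_eq_mk_iff {x y : PathAlgebra K V} :
    mk ρ x = mk ρ y ↔ x - y ∈ TwoSidedIdeal.span ρ := by
  rw [← TwoSidedIdeal.rel_iff]
  exact (RingCon.eq _)

theorem mk_eq_zero_iff {x : PathAlgebra K V} : mk ρ x = 0 ↔ x ∈ TwoSidedIdeal.span ρ := by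
  rw [← map_zero (mk ρ), mk_eq_mk_iff, sub_zero]

/-- The subspace of the linear combinations `∑ kᵢ pᵢ` of (classes of) nontrivial paths. -/
def nontrivialSpan : Submodule K (BoundPathAlgebra ρ) :=
  Submodule.span K {x | ∃ p : QuiverPath V, p.IsNontrivial ∧ x = mk ρ (PathAlgebra.ofPath K p)}

/-- An algebra homomorphism out of `KΓ` that kills `ρ` factors through `K(Γ, ρ)`. -/
def lift {A : Type*} [Ring A] [Algebra K A] (f : PathAlgebra K V →ₐ[K] A)
    (hf : ∀ σ ∈ ρ, f σ = 0) : BoundPathAlgebra ρ →ₐ[K] A where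
  toRingHom := (TwoSidedIdeal.span ρ).ringCon.lift f.toRingHom (by
    have h : TwoSidedIdeal.span ρ ≤ TwoSidedIdeal.ker f :=
      TwoSidedIdeal.span_le.2 fun σ hσ => (TwoSidedIdeal.mem_ker f).2 (hf σ hσ)
    intro x y hxy
    exact (TwoSidedIdeal.ker_ringCon f).1 (TwoSidedIdeal.ringCon_le_iff.1 h hxy))
  commutes' k := f.commutes k

@[simp]
theorem lift_mk {A : Type*} [Ring A] [Algebra K A] (f : PathAlgebra K V →ₐ[K] A)
    (hf : ∀ σ ∈ ρ, f σ = 0) (x : PathAlgebra K V) : lift ρ f hf (mk ρ x) = f x := rfl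

end BoundPathAlgebra

end Quotient

section Dual

variable {K : Type u} [Field K] {V : Type v} [Quiver.{w + 1} V]

/-- The quiver `(Γ₀, Γ₁ ∪ Γ₁*)` is `Symmetrify V`: its arrows from `i` to `j` are the arrows from
`i` to `j` of `Γ` and a reverse `α*` of each arrow `α` from `j` to `i`. It has the same (finite)
set of vertices. -/
instance [Fintype V] : Fintype (Symmetrify V) := inferInstanceAs (Fintype V)

/-- A path of `Γ`, seen as a path of `(Γ₀, Γ₁ ∪ Γ₁*)`. -/
def pathIncl (p : QuiverPath V) : QuiverPath (Symmetrify V) :=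
  ⟨Symmetrify.of.obj p.1, Symmetrify.of.obj p.2.1, Symmetrify.of.mapPath p.2.2⟩

/-- The path `p* = α₁* ⋯ αₙ*` for a path `p = αₙ ⋯ α₁` of `Γ`. -/
def pathStar (p : QuiverPath V) : QuiverPath (Symmetrify V) :=
  ⟨Symmetrify.of.obj p.2.1, Symmetrify.of.obj p.1, (Symmetrify.of.mapPath p.2.2).reverse⟩

variable (K V) in
/-- The linear map from `KΓ` to the path algebra of `(Γ₀, Γ₁ ∪ Γ₁*)` with `p ↦ p`. -/
def inclLin : PathAlgebra K V →ₗ[K] PathAlgebra K (Symmetrify V) :=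
  (PathAlgebra.basis K V).constr K fun p => PathAlgebra.ofPath K (pathIncl p)

variable (K V) in
/-- The linear map from `KΓ` to the path algebra of `(Γ₀, Γ₁ ∪ Γ₁*)` with `p ↦ p*`. -/
def starLin : PathAlgebra K V →ₗ[K] PathAlgebra K (Symmetrify V) :=
  (PathAlgebra.basis K V).constr K fun p => PathAlgebra.ofPath K (pathStar p)

theorem inclLin_ofPath (p : QuiverPath V) :
    inclLin K V (PathAlgebra.ofPath K p) = PathAlgebra.ofPath K (pathIncl p) := by
  rw [inclLin, ← PathAlgebra.basis_apply, Module.Basis.constr_basis]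

theorem starLin_ofPath (p : QuiverPath V) :
    starLin K V (PathAlgebra.ofPath K p) = PathAlgebra.ofPath K (pathStar p) := by
  rw [starLin, ← PathAlgebra.basis_apply, Module.Basis.constr_basis]

/-- The path of length one given by an arrow. -/
def arrowPath {a b : V} (α : a ⟶ b) : QuiverPath V := ⟨a, b, α.toPath⟩

/-- The set `ρ ∪ ρ* ∪ {α β* | α, β ∈ Γ₁}`. (The product `α β*` is `0` unless `s(α) = s(β)`.) -/
def dualRelations (ρ : Set (PathAlgebra K V)) : Set (PathAlgebra K (Symmetrify V)) :=
  inclLin K V '' ρ ∪ starLin K V '' ρ ∪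
    {x | ∃ (a b c d : V) (α : a ⟶ b) (β : c ⟶ d), x =
      PathAlgebra.ofPath K (pathIncl (arrowPath α)) *
        PathAlgebra.ofPath K (pathStar (arrowPath β))}

variable [Fintype V]

/-- The dual extension `𝒟(Λ)` of `Λ = K(Γ, ρ)`: the path algebra of `(Γ₀, Γ₁ ∪ Γ₁*)` with
relations `ρ ∪ ρ* ∪ {α β* | α, β ∈ Γ₁}`. -/
abbrev DualExtension (ρ : Set (PathAlgebra K V)) : Type (max u v (w + 1)) :=
  BoundPathAlgebra (dualRelations ρ)

variable (K V) in
/-- The inclusion of `KΓ` in the path algebra of `(Γ₀, Γ₁ ∪ Γ₁*)`, as an algebra homomorphism. -/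
def inclHom : PathAlgebra K V →ₐ[K] PathAlgebra K (Symmetrify V) :=
  AlgHom.ofLinearMap (inclLin K V)
    (by
      rw [PathAlgebra.one_def, PathAlgebra.one_def, map_sum]
      exact Finset.sum_congr rfl fun i _ => inclLin_ofPath _)
    (by
      intro x y
      induction x using PathAlgebra.induction_on with
      | h0 => simp
      | hadd x x' hx hx' => rw [add_mul, map_add, hx, hx', map_add, add_mul]
      | hsmul k p =>
        induction y using PathAlgebra.induction_on with
        | h0 => simp
        | hadd y y' hy hy' => rw [mul_add, map_add, hy, hy', map_add, mul_add]
        | hsmul l q =>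
          simp only [smul_mul_assoc, mul_smul_comm, map_smul, inclLin_ofPath]
          congr 2
          obtain ⟨a, b, p⟩ := p
          obtain ⟨c, d, q⟩ := q
          rw [PathAlgebra.ofPath_mul_ofPath, PathAlgebra.ofPath_mul_ofPath]
          by_cases h : d = a
          · subst h
            rw [PathAlgebra.pathMul_comp, inclLin_ofPath]
            simp only [pathIncl]
            rw [PathAlgebra.pathMul_comp, Prefunctor.mapPath_comp]
          · rw [PathAlgebra.pathMul_of_ne (by exact h), map_zero,
              PathAlgebra.pathMul_of_ne (by exact h)])

/-- The natural algebra homomorphism from `Λ = K(Γ, ρ)` to `𝒟(Λ)`, through which the elements of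
`Λ` are seen as elements of `𝒟(Λ)`. -/
def toDualExtension (ρ : Set (PathAlgebra K V)) : BoundPathAlgebra ρ →ₐ[K] DualExtension ρ :=
  BoundPathAlgebra.lift ρ ((BoundPathAlgebra.mk (dualRelations ρ)).comp (inclHom K V))
    (fun σ hσ => (BoundPathAlgebra.mk_eq_zero_iff _).2
      (TwoSidedIdeal.subset_span (Or.inl (Or.inl ⟨σ, hσ, rfl⟩))))

end Dual

/-- An (associative) derivation of a not necessarily commutative algebra `A`: a linear map `D` with
`D(ab) = D(a) b + a D(b)`. -/
def IsAssocDerivation {K : Type*} [Field K] {A : Type*} [Ring A] [Algebra K A] (D : A →ₗ[K] A) :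
    Prop :=
  ∀ a b : A, D (a * b) = D a * b + a * D b

/-- A Lie derivation of an associative algebra `A`: a linear map `Θ` with
`Θ([a, b]) = [Θ(a), b] + [a, Θ(b)]`, where `[a, b] = ab - ba`. -/
def IsLieDerivation {K : Type*} [Field K] {A : Type*} [Ring A] [Algebra K A] (Θ : A →ₗ[K] A) :
    Prop :=
  ∀ a b : A, Θ ⁅a, b⁆ = ⁅Θ a, b⁆ + ⁅a, Θ b⁆

end

/-!
Write `e i` for the vertex idempotents and `J` for the Jacobson radical of `𝒟(Λ)`. Modulo the
relations `α β* = 0`, every path folds into a product `q* p`. Since `Γ` has no oriented cycles, for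
`i ≠ j` there are no paths of `Γ` from `i` to `j` or none from `j` to `i`, and so one of the round
trips between `i` and `j` vanishes. Hence the off-diagonal Peirce components lie in `J`, and
`𝒟(Λ) = span (e i) ⊕ J` with commutative quotient `𝒟(Λ) / J`.

Subtracting an inner derivation from `Θ` makes each `Θ (e i)` diagonal, and then `Θ (e i)` is
central because the characteristic is not two. The map `τ` that agrees with `Θ` on the `e i` and
vanishes on `J` is therefore central and kills commutators, so `Θ - τ` is a Lie derivation that
kills the `e i`. It preserves the Peirce components, and on a product of two of them at most one
order of multiplication survives, so the Lie rule is already the Leibniz rule. Nontrivial paths lie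
in `J`, where `τ` vanishes.
-/

section Peirce

variable {K A V : Type*}

section Semiring

variable [CommSemiring K] [Semiring A] [Algebra K A]

variable (K) in
/-- The Peirce component `e i * A * e j` of a family `e` of idempotents, encoded as the space of
elements that are fixed by left multiplication with `e i` and right multiplication with `e j`. -/
def peirceSpace (e : V → A) (i j : V) : Submodule K A where
  carrier := {x | e i * x = x ∧ x * e j = x}
  add_mem' hx hy := ⟨by rw [mul_add, hx.1, hy.1], by rw [add_mul, hx.2, hy.2]⟩
  zero_mem' := ⟨mul_zero _, zero_mul _⟩
  smul_mem' c x hx := ⟨by rw [mul_smul_comm, hx.1], by rw [smul_mul_assoc, hx.2]⟩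

variable {e : V → A} {i j k l : V} {x y : A}

theorem idem_mem_peirceSpace (he : IsIdempotentElem (e i)) : e i ∈ peirceSpace K e i i :=
  ⟨he, he⟩

theorem mul_mem_peirceSpace (hx : x ∈ peirceSpace K e i j) (hy : y ∈ peirceSpace K e k l) :
    x * y ∈ peirceSpace K e i l :=
  ⟨by rw [← mul_assoc, hx.1], by rw [mul_assoc, hy.2]⟩

theorem idem_mul_mul_idem_mem_peirceSpace (he : OrthogonalIdempotents e) (i j : V) (x : A) :
    e i * x * e j ∈ peirceSpace K e i j :=
  ⟨by rw [← mul_assoc, ← mul_assoc, (he.idem i).eq], by rw [mul_assoc, (he.idem j).eq]⟩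

theorem mul_eq_zero_of_mem_peirceSpace (he : OrthogonalIdempotents e) (hjk : j ≠ k)
    (hx : x ∈ peirceSpace K e i j) (hy : y ∈ peirceSpace K e k l) : x * y = 0 := by
  rw [← hx.2, ← hy.1, mul_assoc, ← mul_assoc (e j), he.ortho hjk, zero_mul, mul_zero]

theorem idem_mul_eq_zero_of_mem_peirceSpace (he : OrthogonalIdempotents e) (hki : k ≠ i)
    (hx : x ∈ peirceSpace K e i j) : e k * x = 0 :=
  mul_eq_zero_of_mem_peirceSpace he hki (idem_mem_peirceSpace (K := K) (he.idem k)) hx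

theorem mul_idem_eq_zero_of_mem_peirceSpace (he : OrthogonalIdempotents e) (hjk : j ≠ k)
    (hx : x ∈ peirceSpace K e i j) : x * e k = 0 :=
  mul_eq_zero_of_mem_peirceSpace he hjk hx (idem_mem_peirceSpace (K := K) (he.idem k))

theorem eq_top_of_peirceSpace_le [Fintype V] (he : CompleteOrthogonalIdempotents e)
    {p : Submodule K A} (hp : ∀ i j, peirceSpace K e i j ≤ p) : p = ⊤ := by
  refine eq_top_iff.2 fun x _ => ?_
  have hx : x = ∑ i, ∑ j, e i * x * e j := by
    simp_rw [← Finset.mul_sum, he.complete, mul_one, ← Finset.sum_mul, he.complete, one_mul]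
  rw [hx]
  exact sum_mem fun i _ => sum_mem fun j _ =>
    hp i j (idem_mul_mul_idem_mem_peirceSpace he.toOrthogonalIdempotents i j x)

theorem linearMap_ext_peirceSpace [Fintype V] {M : Type*} [AddCommMonoid M] [Module K M]
    (he : CompleteOrthogonalIdempotents e) {f g : A →ₗ[K] M}
    (hfg : ∀ i j, ∀ x ∈ peirceSpace K e i j, f x = g x) : f = g :=
  LinearMap.eqLocus_eq_top.1 (eq_top_of_peirceSpace_le he hfg)

theorem commute_idem (he : OrthogonalIdempotents e) (i j : V) : Commute (e i) (e j) := by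
  rcases eq_or_ne i j with rfl | hij
  · exact Commute.refl _
  · exact (he.ortho hij).trans (he.ortho hij.symm).symm

theorem commute_sum_idem_mul_mul_idem [Fintype V] (he : OrthogonalIdempotents e) (i : V) (x : A) :
    Commute (e i) (∑ j, e j * x * e j) := by
  classical
  have hleft : e i * ∑ j, e j * x * e j = e i * x * e i := by
    simp only [Finset.mul_sum, ← mul_assoc, he.mul_eq, ite_mul, zero_mul, Finset.sum_ite_eq,
      Finset.mem_univ, if_true]
  have hright : (∑ j, e j * x * e j) * e i = e i * x * e i := by
    simp only [Finset.sum_mul, mul_assoc, he.mul_eq, mul_ite, mul_zero, Finset.sum_ite_eq',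
      Finset.mem_univ, if_true]
  exact hleft.trans hright.symm

theorem commute_of_mem_span_idem (he : OrthogonalIdempotents e)
    (hx : x ∈ Submodule.span K (Set.range e)) (hy : y ∈ Submodule.span K (Set.range e)) :
    Commute x y := by
  refine Algebra.commute_of_mem_adjoin_of_forall_mem_commute (Algebra.span_le_adjoin K _ hy) ?_
  rintro _ ⟨j, rfl⟩
  refine (Algebra.commute_of_mem_adjoin_of_forall_mem_commute
    (Algebra.span_le_adjoin K _ hx) ?_).symm
  rintro _ ⟨i, rfl⟩
  exact commute_idem he j i

variable (K) in
/-- A complete family of orthogonal idempotents is directed if, for distinct `i` and `j`, one of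
the round trips `e i * A * e j * A * e i` and `e j * A * e i * A * e j` vanishes, and if every
diagonal Peirce component is spanned by its idempotent and by round trips. -/
structure IsDirectedPeirce [Fintype V] (e : V → A) : Prop
    extends CompleteOrthogonalIdempotents e where
  mul_eq_zero_or : ∀ i j, i ≠ j →
    (∀ x ∈ peirceSpace K e i j, ∀ y ∈ peirceSpace K e j i, x * y = 0) ∨
      (∀ x ∈ peirceSpace K e i j, ∀ y ∈ peirceSpace K e j i, y * x = 0)
  diag_le : ∀ i, peirceSpace K e i i ≤
    Submodule.span K {e i} ⊔ ⨆ j, ⨆ _ : j ≠ i, peirceSpace K e i j * peirceSpace K e j i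

theorem IsDirectedPeirce.peirceSpace_self_le [Fintype V] (he : IsDirectedPeirce K e)
    {p : Submodule K A} (hidem : e i ∈ p)
    (hmul : ∀ j, j ≠ i → peirceSpace K e i j * peirceSpace K e j i ≤ p) :
    peirceSpace K e i i ≤ p :=
  (he.diag_le i).trans <| sup_le ((Submodule.span_singleton_le_iff_mem _ _).2 hidem)
    (iSup₂_le hmul)

theorem IsDirectedPeirce.eq_top [Fintype V] (he : IsDirectedPeirce K e) {p : Submodule K A}
    (hidem : ∀ i, e i ∈ p) (hoff : ∀ i j, i ≠ j → peirceSpace K e i j ≤ p)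
    (hmul : ∀ i j, i ≠ j → peirceSpace K e i j * peirceSpace K e j i ≤ p) : p = ⊤ := by
  refine eq_top_of_peirceSpace_le he.toCompleteOrthogonalIdempotents fun i j => ?_
  rcases eq_or_ne i j with rfl | hij
  · exact he.peirceSpace_self_le (hidem i) fun j hji => hmul i j hji.symm
  · exact hoff i j hij

/-- The space of all `x` such that `D` satisfies the Leibniz rule on every product `x * y`. -/
def leibnizSpace (D : A →ₗ[K] A) : Submodule K A where
  carrier := {x | ∀ y, D (x * y) = D x * y + x * D y}
  add_mem' hx hy z := by
    rw [add_mul, map_add, hx z, hy z, map_add, add_mul, add_mul, add_add_add_comm]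
  zero_mem' y := by simp only [zero_mul, map_zero, add_zero]
  smul_mem' c x hx y := by
    rw [smul_mul_assoc, map_smul, hx y, map_smul, smul_add, smul_mul_assoc, smul_mul_assoc]

theorem mul_mem_leibnizSpace {D : A →ₗ[K] A} (hx : x ∈ leibnizSpace D)
    (hy : y ∈ leibnizSpace D) : x * y ∈ leibnizSpace D := by
  intro z
  rw [mul_assoc, hx, hy, hx, add_mul, mul_add, mul_assoc, mul_assoc, mul_assoc, add_assoc]

theorem mul_mem_of_mem_span {s : Set A} {N : Submodule K A} {a : A} (h : ∀ y ∈ s, a * y ∈ N)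
    (hx : x ∈ Submodule.span K s) : a * x ∈ N :=
  (Submodule.span_le (p := N.comap (LinearMap.mulLeft K a))).2 h hx

theorem mul_eq_zero_of_mem_span {s t : Set A} (h : ∀ a ∈ s, ∀ b ∈ t, a * b = 0)
    (hx : x ∈ Submodule.span K s) (hy : y ∈ Submodule.span K t) : x * y = 0 := by
  have hxy := Submodule.mul_mem_mul hx hy
  rw [Submodule.span_mul_span] at hxy
  refine (Submodule.span_eq_bot.2 ?_).le hxy
  rintro _ ⟨a, ha, b, hb, rfl⟩
  exact h a ha b hb

end Semiring

attribute [local instance 100] LieRing.ofAssociativeRing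

section Ring

variable [CommRing K] [Ring A] [Algebra K A] {e : V → A} {i j : V} {x : A}

theorem lie_mem_peirceSpace {c : A} (hi : Commute (e i) c) (hj : Commute (e j) c)
    (hx : x ∈ peirceSpace K e i j) : ⁅c, x⁆ ∈ peirceSpace K e i j := by
  rw [Ring.lie_def]
  refine sub_mem ⟨?_, ?_⟩ ⟨?_, ?_⟩
  · rw [← mul_assoc, hi.eq, mul_assoc, hx.1]
  · rw [mul_assoc, hx.2]
  · rw [← mul_assoc, hx.1]
  · rw [mul_assoc, ← hj.eq, ← mul_assoc, hx.2]

theorem idem_lie_of_mem_peirceSpace (he : OrthogonalIdempotents e) (hij : i ≠ j)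
    (hx : x ∈ peirceSpace K e i j) : ⁅e i, x⁆ = x := by
  rw [Ring.lie_def, hx.1, mul_idem_eq_zero_of_mem_peirceSpace he hij.symm hx, sub_zero]

theorem lie_idem_of_mem_peirceSpace (he : OrthogonalIdempotents e) (hij : i ≠ j)
    (hx : x ∈ peirceSpace K e i j) : ⁅x, e j⁆ = x := by
  rw [Ring.lie_def, hx.2, idem_mul_eq_zero_of_mem_peirceSpace he hij.symm hx, sub_zero]

end Ring

section Derivation

variable [Field K] [Ring A] [Algebra K A]

theorem isAssocDerivation_ad (t : A) : IsAssocDerivation (LieAlgebra.ad K A t) := by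
  intro a b
  simp only [LieAlgebra.ad_apply, Ring.lie_def]
  noncomm_ring

theorem IsAssocDerivation.isLieDerivation {D : A →ₗ[K] A} (hD : IsAssocDerivation D) :
    IsLieDerivation D := by
  intro a b
  simp only [Ring.lie_def, map_sub, hD a b, hD b a]
  abel

theorem IsAssocDerivation.add {D E : A →ₗ[K] A} (hD : IsAssocDerivation D)
    (hE : IsAssocDerivation E) : IsAssocDerivation (D + E) := by
  intro a b
  simp only [LinearMap.add_apply, hD a b, hE a b, add_mul, mul_add]
  abel

theorem IsLieDerivation.sub {Θ Δ : A →ₗ[K] A} (hΘ : IsLieDerivation Θ)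
    (hΔ : IsLieDerivation Δ) : IsLieDerivation (Θ - Δ) := by
  intro a b
  simp only [LinearMap.sub_apply, hΘ a b, hΔ a b, sub_lie, lie_sub]
  abel

theorem isLieDerivation_of_central {τ : A →ₗ[K] A} (hτ : ∀ a b, Commute (τ a) b)
    (hτ' : ∀ a b : A, τ ⁅a, b⁆ = 0) : IsLieDerivation τ := by
  intro a b
  rw [hτ', (hτ a b).lie_eq, (hτ b a).symm.lie_eq, add_zero]

theorem eq_zero_and_fixed_of_eq_add_lie (h2 : (2 : K) ≠ 0) {a y z : A}
    (ha : IsIdempotentElem a) (haz : a * z = z) (hza : z * a = 0) (h : y = z + ⁅a, y⁆) :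
    z = 0 ∧ a * y = y ∧ y * a = 0 := by
  rw [Ring.lie_def] at h
  have hz : z = a * y * a := by
    have hay : a * y = z + (a * y - a * y * a) := by
      nth_rewrite 1 [h]
      rw [mul_add, mul_sub, haz, ← mul_assoc, ha.eq, mul_assoc]
    rwa [← add_sub_assoc, add_comm, add_sub_assoc, left_eq_add, sub_eq_zero] at hay
  have hya : y * a = z - y * a := by
    nth_rewrite 1 [h]
    rw [add_mul, sub_mul, hza, zero_add, mul_assoc y, ha.eq, hz]
  have hz0 : z = 0 := by
    have haya := congrArg (a * ·) hya
    simpa only [mul_sub, haz, ← mul_assoc, ← hz, sub_self] using haya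
  have hya0 : y * a = 0 := by
    have h2ya : (2 : K) • (y * a) = 0 := by
      rw [two_smul]
      nth_rewrite 1 [hya]
      rw [sub_add_cancel, hz0]
    exact (smul_eq_zero.1 h2ya).resolve_left h2
  exact ⟨hz0, by rw [hz0, hya0, zero_add, sub_zero] at h; exact h.symm, hya0⟩

namespace IsLieDerivation

variable {e : V → A} {Θ : A →ₗ[K] A}

/- With `t = ∑ l, Θ (e l) * e l`, applying `Θ` to `⁅e i, e l⁆ = 0` shows that `Θ (e i) - ⁅t, e i⁆`
is the diagonal part of `Θ (e i)`. -/
theorem exists_commute_sub_ad [Fintype V] (hΘ : IsLieDerivation Θ)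
    (he : CompleteOrthogonalIdempotents e) :
    ∃ t : A, ∀ i j, Commute (e j) ((Θ - LieAlgebra.ad K A t) (e i)) := by
  classical
  refine ⟨∑ l, Θ (e l) * e l, fun i j => ?_⟩
  have hlie (l : V) : ⁅Θ (e i), e l⁆ + ⁅e i, Θ (e l)⁆ = 0 := by
    have hcomm : ⁅e i, e l⁆ = 0 :=
      (commute_idem he.toOrthogonalIdempotents i l).lie_eq
    rw [← hΘ, hcomm, map_zero]
  have hterm (l : V) : Θ (e i) * e l - e l * Θ (e i) * e l =
      Θ (e l) * (e i * e l) - e i * (Θ (e l) * e l) := by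
    have h := congrArg (· * e l) (hlie l)
    simp only [Ring.lie_def, add_mul, sub_mul, zero_mul, mul_assoc, (he.idem l).eq] at h
    rw [← sub_eq_zero, ← h, mul_assoc]
    abel
  have hsum : Θ (e i) - ∑ l, e l * Θ (e i) * e l =
      Θ (e i) * e i - e i * ∑ l, Θ (e l) * e l := by
    have h := Finset.sum_congr (rfl : Finset.univ = Finset.univ) fun l _ => hterm l
    simpa only [Finset.sum_sub_distrib, ← Finset.mul_sum, he.complete, mul_one, he.mul_eq, mul_ite,
      mul_zero, Finset.sum_ite_eq, Finset.mem_univ, if_true] using h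
  have hdiag : (Θ - LieAlgebra.ad K A (∑ l, Θ (e l) * e l)) (e i) = ∑ l, e l * Θ (e i) * e l := by
    have ht : (∑ l, Θ (e l) * e l) * e i = Θ (e i) * e i := by
      simp [Finset.sum_mul, mul_assoc, he.mul_eq]
    rw [LinearMap.sub_apply, LieAlgebra.ad_apply, Ring.lie_def, ht, ← hsum, sub_sub_cancel]
  rw [hdiag]
  exact commute_sum_idem_mul_mul_idem he.toOrthogonalIdempotents j _

theorem lie_map_idem_left (h2 : (2 : K) ≠ 0) (hΘ : IsLieDerivation Θ)
    (he : OrthogonalIdempotents e) (hc : ∀ i j, Commute (e j) (Θ (e i))) {i j : V} (hij : i ≠ j)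
    {x : A} (hx : x ∈ peirceSpace K e i j) : ⁅Θ (e i), x⁆ = 0 ∧ e i * Θ x = Θ x := by
  have hz := lie_mem_peirceSpace (hc i i) (hc i j) hx
  have h : Θ x = ⁅Θ (e i), x⁆ + ⁅e i, Θ x⁆ := by
    rw [← hΘ, idem_lie_of_mem_peirceSpace he hij hx]
  have key := eq_zero_and_fixed_of_eq_add_lie h2 (he.idem i) hz.1
    (mul_idem_eq_zero_of_mem_peirceSpace he hij.symm hz) h
  exact ⟨key.1, key.2.1⟩

theorem lie_map_idem_right (h2 : (2 : K) ≠ 0) (hΘ : IsLieDerivation Θ)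
    (he : OrthogonalIdempotents e) (hc : ∀ i j, Commute (e j) (Θ (e i))) {i j : V} (hij : i ≠ j)
    {x : A} (hx : x ∈ peirceSpace K e i j) : ⁅Θ (e j), x⁆ = 0 ∧ Θ x * e j = Θ x := by
  have hz := neg_mem (lie_mem_peirceSpace (hc j i) (hc j j) hx)
  have h : Θ x = -⁅Θ (e j), x⁆ + ⁅1 - e j, Θ x⁆ := by
    have hlie := hΘ x (e j)
    rw [lie_idem_of_mem_peirceSpace he hij hx] at hlie
    nth_rewrite 1 [hlie]
    simp only [Ring.lie_def]
    noncomm_ring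
  have key := eq_zero_and_fixed_of_eq_add_lie h2 (he.idem j).one_sub
    (by rw [sub_mul, one_mul, idem_mul_eq_zero_of_mem_peirceSpace he hij.symm hz, sub_zero])
    (by rw [mul_sub, mul_one, hz.2, sub_self]) h
  refine ⟨neg_eq_zero.1 key.1, ?_⟩
  rw [mul_sub, mul_one, sub_eq_zero] at key
  exact key.2.2.symm

theorem map_mem_peirceSpace (h2 : (2 : K) ≠ 0) (hΘ : IsLieDerivation Θ)
    (he : OrthogonalIdempotents e) (hc : ∀ i j, Commute (e j) (Θ (e i))) {i j : V} (hij : i ≠ j)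
    {x : A} (hx : x ∈ peirceSpace K e i j) : Θ x ∈ peirceSpace K e i j :=
  ⟨(lie_map_idem_left h2 hΘ he hc hij hx).2, (lie_map_idem_right h2 hΘ he hc hij hx).2⟩

theorem lie_map_idem_eq_zero (h2 : (2 : K) ≠ 0) (hΘ : IsLieDerivation Θ)
    (he : OrthogonalIdempotents e) (hc : ∀ i j, Commute (e j) (Θ (e i))) {i j : V} (hij : i ≠ j)
    {x : A} (hx : x ∈ peirceSpace K e i j) (k : V) : ⁅Θ (e k), x⁆ = 0 := by
  rcases eq_or_ne k i with rfl | hki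
  · exact (lie_map_idem_left h2 hΘ he hc hij hx).1
  rcases eq_or_ne k j with rfl | hkj
  · exact (lie_map_idem_right h2 hΘ he hc hij hx).1
  have hlie {y : A} (hy : y ∈ peirceSpace K e i j) : ⁅e k, y⁆ = 0 := by
    rw [Ring.lie_def, idem_mul_eq_zero_of_mem_peirceSpace he hki hy,
      mul_idem_eq_zero_of_mem_peirceSpace he hkj.symm hy, sub_zero]
  have h := hΘ (e k) x
  rwa [hlie hx, hlie (map_mem_peirceSpace h2 hΘ he hc hij hx), map_zero, add_zero, eq_comm] at h

theorem commute_map_idem [Fintype V] (h2 : (2 : K) ≠ 0) (hΘ : IsLieDerivation Θ)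
    (he : IsDirectedPeirce K e) (hc : ∀ i j, Commute (e j) (Θ (e i))) (k : V) (x : A) :
    Commute (Θ (e k)) x := by
  let C := Subalgebra.centralizer K {Θ (e k)}
  have hmem {y : A} (hy : Commute (Θ (e k)) y) : y ∈ C :=
    (Subalgebra.mem_centralizer_iff K).2 fun _ ha => ha ▸ hy.eq
  have hoff (i j : V) (hij : i ≠ j) : peirceSpace K e i j ≤ C.toSubmodule := fun y hy =>
    hmem (sub_eq_zero.1 (lie_map_idem_eq_zero h2 hΘ he.toOrthogonalIdempotents hc hij hy k))
  have htop : C.toSubmodule = ⊤ := he.eq_top (fun i => hmem (hc k i).symm) hoff fun i j hij =>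
    Submodule.mul_le.2 fun y hy z hz => C.mul_mem (hoff i j hij hy) (hoff j i hij.symm hz)
  have hx : x ∈ C.toSubmodule := htop ▸ Submodule.mem_top
  exact (Subalgebra.mem_centralizer_iff K).1 hx _ rfl

theorem map_mul_of_mem_peirceSpace [Fintype V] (h2 : (2 : K) ≠ 0) (hΘ : IsLieDerivation Θ)
    (he : IsDirectedPeirce K e) (hc : ∀ i j, Commute (e j) (Θ (e i))) {i j : V} (hij : i ≠ j)
    {x y : A} (hx : x ∈ peirceSpace K e i j) (hy : y ∈ peirceSpace K e j i) :
    Θ (x * y) = Θ x * y + x * Θ y := by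
  have hΘx := map_mem_peirceSpace h2 hΘ he.toOrthogonalIdempotents hc hij hx
  have hΘy := map_mem_peirceSpace h2 hΘ he.toOrthogonalIdempotents hc hij.symm hy
  rcases he.mul_eq_zero_or i j hij with h | h
  · rw [h x hx y hy, h _ hΘx y hy, h x hx _ hΘy, map_zero, add_zero]
  · have hlie := hΘ x y
    simpa only [Ring.lie_def, h x hx y hy, h _ hΘx y hy, h x hx _ hΘy, sub_zero] using hlie

theorem map_mem_peirceSpace_of_map_idem [Fintype V] (h2 : (2 : K) ≠ 0) (hΘ : IsLieDerivation Θ)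
    (he : IsDirectedPeirce K e) (h0 : ∀ i, Θ (e i) = 0) (i j : V) {x : A}
    (hx : x ∈ peirceSpace K e i j) : Θ x ∈ peirceSpace K e i j := by
  have hc (i j : V) : Commute (e j) (Θ (e i)) := h0 i ▸ Commute.zero_right _
  have hoff {i j : V} (hij : i ≠ j) {x : A} := map_mem_peirceSpace (x := x) h2 hΘ
    he.toOrthogonalIdempotents hc hij
  rcases eq_or_ne i j with rfl | hij
  · have hdiag : peirceSpace K e i i ≤ (peirceSpace K e i i).comap Θ := by
      refine he.peirceSpace_self_le ?_ fun k hki => Submodule.mul_le.2 fun y hy z hz => ?_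
      · rw [Submodule.mem_comap, h0]
        exact zero_mem _
      · rw [Submodule.mem_comap, map_mul_of_mem_peirceSpace h2 hΘ he hc hki.symm hy hz]
        exact add_mem (mul_mem_peirceSpace (hoff hki.symm hy) hz)
          (mul_mem_peirceSpace hy (hoff hki hz))
    exact hdiag hx
  · exact hoff hij hx

theorem idem_mem_leibnizSpace [Fintype V] (h2 : (2 : K) ≠ 0) (hΘ : IsLieDerivation Θ)
    (he : IsDirectedPeirce K e) (h0 : ∀ i, Θ (e i) = 0) (i : V) : e i ∈ leibnizSpace Θ := by
  have hcomm : Θ ∘ₗ LinearMap.mulLeft K (e i) = LinearMap.mulLeft K (e i) ∘ₗ Θ := by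
    refine linearMap_ext_peirceSpace he.toCompleteOrthogonalIdempotents fun k l x hx => ?_
    have hΘx := map_mem_peirceSpace_of_map_idem h2 hΘ he h0 k l hx
    simp only [LinearMap.comp_apply, LinearMap.mulLeft_apply]
    rcases eq_or_ne i k with rfl | hik
    · rw [hx.1, hΘx.1]
    · rw [idem_mul_eq_zero_of_mem_peirceSpace he.toOrthogonalIdempotents hik hx,
        idem_mul_eq_zero_of_mem_peirceSpace he.toOrthogonalIdempotents hik hΘx, map_zero]
  intro y
  rw [h0, zero_mul, zero_add]
  exact LinearMap.congr_fun hcomm y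

theorem peirceSpace_le_leibnizSpace [Fintype V] (h2 : (2 : K) ≠ 0) (hΘ : IsLieDerivation Θ)
    (he : IsDirectedPeirce K e) (h0 : ∀ i, Θ (e i) = 0) {i j : V} (hij : i ≠ j) :
    peirceSpace K e i j ≤ leibnizSpace Θ := by
  intro x hx
  have hmem {k l : V} {y : A} := map_mem_peirceSpace_of_map_idem (x := y) h2 hΘ he h0 k l
  have hmul {k l m n : V} {y z : A} (hlm : l ≠ m) (hy : y ∈ peirceSpace K e k l)
      (hz : z ∈ peirceSpace K e m n) : y * z = 0 :=
    mul_eq_zero_of_mem_peirceSpace he.toOrthogonalIdempotents hlm hy hz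
  have hext : Θ ∘ₗ LinearMap.mulLeft K x =
      LinearMap.mulLeft K (Θ x) + LinearMap.mulLeft K x ∘ₗ Θ := by
    refine linearMap_ext_peirceSpace he.toCompleteOrthogonalIdempotents fun k l y hy => ?_
    simp only [LinearMap.comp_apply, LinearMap.add_apply, LinearMap.mulLeft_apply]
    rcases eq_or_ne j k with rfl | hjk
    · rcases eq_or_ne l i with rfl | hli
      · exact map_mul_of_mem_peirceSpace h2 hΘ he (fun i j => h0 i ▸ Commute.zero_right _) hij
          hx hy
      · have hlie := hΘ x y
        simpa only [Ring.lie_def, hmul hli hy hx, hmul hli (hmem hy) hx, hmul hli hy (hmem hx),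
          sub_zero] using hlie
    · rw [hmul hjk hx hy, hmul hjk (hmem hx) hy, hmul hjk hx (hmem hy), map_zero, add_zero]
  exact LinearMap.congr_fun hext

theorem isAssocDerivation_of_map_idem [Fintype V] (h2 : (2 : K) ≠ 0) (hΘ : IsLieDerivation Θ)
    (he : IsDirectedPeirce K e) (h0 : ∀ i, Θ (e i) = 0) : IsAssocDerivation Θ := by
  have hoff {i j : V} (hij : i ≠ j) := peirceSpace_le_leibnizSpace h2 hΘ he h0 hij
  have htop : leibnizSpace Θ = ⊤ :=
    he.eq_top (idem_mem_leibnizSpace h2 hΘ he h0) (fun _ _ => hoff) fun _ _ hij =>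
      Submodule.mul_le.2 fun _ hx _ hy =>
        mul_mem_leibnizSpace (hoff hij hx) (hoff hij.symm hy)
  exact fun x => (htop ▸ Submodule.mem_top : x ∈ leibnizSpace Θ)

end IsLieDerivation

theorem mem_jacobson_of_forall_mul_mul_eq_zero {R : Type*} [Ring R] {x : R}
    (hx : ∀ a, x * a * x = 0) : x ∈ Ring.jacobson R := by
  rw [← Ideal.jacobson_bot, Ideal.mem_jacobson_iff]
  refine fun a => ⟨1 - a * x, ?_⟩
  have hsq : a * x * a * x = 0 := by rw [mul_assoc a, mul_assoc a, hx, mul_zero]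
  rw [Submodule.mem_bot, sub_mul, sub_mul, one_mul, hsq]
  abel

theorem eq_zero_of_isIdempotentElem_of_mem_jacobson {R : Type*} [Ring R] {x : R}
    (hx : IsIdempotentElem x) (hxJ : x ∈ Ring.jacobson R) : x = 0 := by
  rw [← Ideal.jacobson_bot, Ideal.mem_jacobson_iff] at hxJ
  obtain ⟨z, hz⟩ := hxJ (-1)
  rw [Submodule.mem_bot] at hz
  have hzx := congrArg (· * x) hz
  simp only [sub_mul, add_mul, mul_assoc, hx.eq, one_mul, zero_mul, neg_mul, mul_neg,
    neg_add_cancel, zero_sub, neg_eq_zero] at hzx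
  exact hzx

theorem disjoint_span_idem_jacobson {e : V → A} (he : OrthogonalIdempotents e) :
    Disjoint (Submodule.span K (Set.range e)) ((Ring.jacobson A).restrictScalars K) := by
  rw [Submodule.disjoint_def]
  intro x hx hxJ
  obtain ⟨c, rfl⟩ := Finsupp.mem_span_range_iff_exists_finsupp.1 hx
  refine Finset.sum_eq_zero fun i hi => ?_
  change c i • e i = 0
  have hmul : e i * c.sum (fun j a => a • e j) = c i • e i := by
    classical
    simp only [Finsupp.sum, Finset.mul_sum, mul_smul_comm, he.mul_eq, smul_ite, smul_zero,
      Finset.sum_ite_eq, hi, if_true]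
  have hci : c i • e i ∈ (Ring.jacobson A).restrictScalars K :=
    hmul ▸ (Ring.jacobson A).mul_mem_left (e i) hxJ
  by_contra hne
  have hei : e i ∈ Ring.jacobson A :=
    (Submodule.smul_mem_iff _ (left_ne_zero_of_smul hne)).1 hci
  exact hne (by rw [eq_zero_of_isIdempotentElem_of_mem_jacobson (he.idem i) hei, smul_zero])

namespace IsDirectedPeirce

variable [Fintype V] {e : V → A}

theorem peirceSpace_le_jacobson (he : IsDirectedPeirce K e) {i j : V} (hij : i ≠ j) :
    peirceSpace K e i j ≤ (Ring.jacobson A).restrictScalars K := by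
  intro x hx
  refine mem_jacobson_of_forall_mul_mul_eq_zero fun a => ?_
  have hxax : x * a * x = x * (e j * a * e i) * x := by
    rw [← mul_assoc, ← mul_assoc, hx.2, mul_assoc _ (e i), hx.1]
  have ha := idem_mul_mul_idem_mem_peirceSpace (K := K) he.toOrthogonalIdempotents j i a
  rw [hxax]
  rcases he.mul_eq_zero_or i j hij with h | h
  · rw [h x hx _ ha, zero_mul]
  · rw [mul_assoc, h x hx _ ha, mul_zero]

theorem isCompl_span_idem_jacobson (he : IsDirectedPeirce K e) :
    IsCompl (Submodule.span K (Set.range e)) ((Ring.jacobson A).restrictScalars K) := by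
  refine ⟨disjoint_span_idem_jacobson he.toOrthogonalIdempotents, codisjoint_iff.2 <|
    he.eq_top (fun i => ?_) (fun i j hij => ?_) fun i j hij => ?_⟩
  · exact Submodule.mem_sup_left (Submodule.subset_span ⟨i, rfl⟩)
  · exact (he.peirceSpace_le_jacobson hij).trans le_sup_right
  · have hmul : peirceSpace K e i j * peirceSpace K e j i ≤
        (Ring.jacobson A).restrictScalars K :=
      Submodule.mul_le.2 fun x _ y hy =>
        (Ring.jacobson A).mul_mem_left x (he.peirceSpace_le_jacobson hij.symm hy)
    exact hmul.trans le_sup_right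

theorem lie_mem_jacobson (he : IsDirectedPeirce K e) (a b : A) : ⁅a, b⁆ ∈ Ring.jacobson A := by
  set J := Ring.jacobson A
  have hdecomp (x : A) : ∃ s ∈ Submodule.span K (Set.range e), ∃ u ∈ J, s + u = x :=
    Submodule.mem_sup.1 (he.isCompl_span_idem_jacobson.sup_eq_top ▸ Submodule.mem_top)
  obtain ⟨s, hs, u, hu, rfl⟩ := hdecomp a
  obtain ⟨t, ht, v, hv, rfl⟩ := hdecomp b
  have hst := commute_of_mem_span_idem he.toOrthogonalIdempotents hs ht
  have hlie : ⁅s + u, t + v⁆ = u * (t + v) - (t + v) * u + (s * v - v * s) := by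
    rw [Ring.lie_def, add_mul, mul_add s, mul_add (t + v), add_mul t, hst.eq]
    abel
  rw [hlie]
  exact add_mem (sub_mem (J.mul_mem_right _ hu) (J.mul_mem_left _ hu))
    (sub_mem (J.mul_mem_left _ hv) (J.mul_mem_right _ hv))

theorem isLieDerivation_comp_projection (he : IsDirectedPeirce K e) {Φ : A →ₗ[K] A}
    (hΦ : ∀ i b, Commute (Φ (e i)) b) :
    IsLieDerivation (Φ ∘ₗ Submodule.projection _ _ he.isCompl_span_idem_jacobson) := by
  have hcompl := he.isCompl_span_idem_jacobson
  refine isLieDerivation_of_central (fun a b => ?_) fun a b => ?_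
  · obtain ⟨c, hca⟩ := (Submodule.mem_span_range_iff_exists_fun K).1
      (Submodule.projection_apply_mem hcompl a)
    rw [LinearMap.comp_apply, ← hca, map_sum]
    refine Commute.sum_left _ _ _ fun i _ => ?_
    rw [map_smul]
    exact (hΦ i b).smul_left _
  · rw [LinearMap.comp_apply,
      (Submodule.projection_apply_eq_zero_iff hcompl).2 (he.lie_mem_jacobson a b), map_zero]

theorem exists_isAssocDerivation_eqOn_jacobson (he : IsDirectedPeirce K e) (h2 : (2 : K) ≠ 0)
    {Θ : A →ₗ[K] A} (hΘ : IsLieDerivation Θ) :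
    ∃ D : A →ₗ[K] A, IsAssocDerivation D ∧ ∀ x ∈ Ring.jacobson A, Θ x = D x := by
  obtain ⟨t, hc⟩ := hΘ.exists_commute_sub_ad he.toCompleteOrthogonalIdempotents
  have had := isAssocDerivation_ad (K := K) t
  set Φ : A →ₗ[K] A := Θ - LieAlgebra.ad K A t with hΦ_def
  have hΦ : IsLieDerivation Φ := hΘ.sub had.isLieDerivation
  have hcompl := he.isCompl_span_idem_jacobson
  set τ : A →ₗ[K] A := Φ ∘ₗ Submodule.projection _ _ hcompl
  have hτ : IsLieDerivation τ :=
    he.isLieDerivation_comp_projection (IsLieDerivation.commute_map_idem h2 hΦ he hc)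
  have hτe (i : V) : τ (e i) = Φ (e i) := by
    rw [LinearMap.comp_apply, Submodule.projection_apply_of_mem_left hcompl
      (Submodule.subset_span ⟨i, rfl⟩)]
  have hτJ (x : A) (hx : x ∈ Ring.jacobson A) : τ x = 0 := by
    rw [LinearMap.comp_apply, (Submodule.projection_apply_eq_zero_iff hcompl).2 hx, map_zero]
  have hD : IsAssocDerivation (Φ - τ) := IsLieDerivation.isAssocDerivation_of_map_idem h2
    (hΦ.sub hτ) he fun i => by rw [LinearMap.sub_apply, hτe, sub_self]
  refine ⟨Φ - τ + LieAlgebra.ad K A t, hD.add had, fun x hx => ?_⟩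
  rw [LinearMap.add_apply, LinearMap.sub_apply, hτJ x hx, sub_zero, hΦ_def, LinearMap.sub_apply,
    sub_add_cancel]

end IsDirectedPeirce

end Derivation

end Peirce

theorem QuiverPath.IsNontrivial.pathIncl {V : Type v} [Quiver.{w + 1} V] {p : QuiverPath V}
    (hp : p.IsNontrivial) : (pathIncl p).IsNontrivial := by
  obtain ⟨a, b, p⟩ := p
  cases p with
  | nil => exact hp
  | cons p α => exact Nat.le_add_left _ _

noncomputable section PathAlgebras

open Quiver

variable {K : Type u} [Field K] {V : Type v} [Quiver.{w + 1} V]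

theorem HasNoOrientedCycles.isEmpty_path_or (hΓ : HasNoOrientedCycles V) {i j : V} (hij : i ≠ j) :
    IsEmpty (Path i j) ∨ IsEmpty (Path j i) := by
  refine or_iff_not_imp_left.2 fun h => ⟨fun q => h ⟨fun p => hij ?_⟩⟩
  have hlen := hΓ i (p.comp q)
  rw [Path.length_comp, Nat.add_eq_zero_iff] at hlen
  exact p.eq_of_length_zero hlen.1

theorem PathAlgebra.completeOrthogonalIdempotents_idem [Fintype V] :
    CompleteOrthogonalIdempotents (PathAlgebra.idem K : V → PathAlgebra K V) where
  idem _ := (ofPath_mul_ofPath _ _).trans (pathMul_comp _ _)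
  ortho _ _ hij := (ofPath_mul_ofPath _ _).trans (pathMul_of_ne hij.symm)
  complete := rfl

namespace BoundPathAlgebra

variable [Fintype V] (ρ : Set (PathAlgebra K V))

/-- The class in `K(Γ, ρ)` of the trivial path `e_i` at the vertex `i`. -/
def idem (i : V) : BoundPathAlgebra ρ := mk ρ (PathAlgebra.idem K i)

theorem completeOrthogonalIdempotents_idem : CompleteOrthogonalIdempotents (idem ρ) :=
  PathAlgebra.completeOrthogonalIdempotents_idem.map (mk ρ).toRingHom

theorem mk_ofPath_mul_mk_ofPath {a b c : V} (p : Path b c) (q : Path a b) :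
    mk ρ (PathAlgebra.ofPath K ⟨b, c, p⟩) * mk ρ (PathAlgebra.ofPath K ⟨a, b, q⟩) =
      mk ρ (PathAlgebra.ofPath K ⟨a, c, q.comp p⟩) := by
  rw [← map_mul, PathAlgebra.ofPath_mul_ofPath, PathAlgebra.pathMul_comp]

theorem mk_ofPath_mem_peirceSpace {a b : V} (p : Path a b) :
    mk ρ (PathAlgebra.ofPath K ⟨a, b, p⟩) ∈ peirceSpace K (idem ρ) b a :=
  ⟨(mk_ofPath_mul_mk_ofPath ρ Path.nil p).trans (by rw [Path.comp_nil]),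
    (mk_ofPath_mul_mk_ofPath ρ p Path.nil).trans (by rw [Path.nil_comp])⟩

theorem peirceSpace_le_span (i j : V) : peirceSpace K (idem ρ) i j ≤
    Submodule.span K {x | ∃ p : Path j i, x = mk ρ (PathAlgebra.ofPath K ⟨j, i, p⟩)} := by
  intro x hx
  have he := (completeOrthogonalIdempotents_idem ρ).toOrthogonalIdempotents
  rw [← hx.2, ← hx.1]
  obtain ⟨x, rfl⟩ := mk_surjective ρ x
  clear hx
  induction x using PathAlgebra.induction_on with
  | h0 => simp only [map_zero, mul_zero, zero_mul, zero_mem]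
  | hadd x y hx hy =>
    rw [map_add, mul_add, add_mul]
    exact add_mem hx hy
  | hsmul k p =>
    obtain ⟨a, b, p⟩ := p
    have hp := mk_ofPath_mem_peirceSpace ρ p
    rw [map_smul, mul_smul_comm, smul_mul_assoc]
    refine Submodule.smul_mem _ _ ?_
    rcases eq_or_ne i b with rfl | hib
    · rw [hp.1]
      rcases eq_or_ne a j with rfl | haj
      · rw [hp.2]
        exact Submodule.subset_span ⟨p, rfl⟩
      · rw [mul_idem_eq_zero_of_mem_peirceSpace he haj hp]
        exact zero_mem _
    · rw [idem_mul_eq_zero_of_mem_peirceSpace he hib hp, zero_mul]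
      exact zero_mem _

end BoundPathAlgebra

namespace DualExtension

open PathAlgebra BoundPathAlgebra

variable [Fintype V] (ρ : Set (PathAlgebra K V))

/-- The class in `𝒟(Λ)` of a path `p` of `Γ`. -/
def forward {a b : V} (p : Path a b) : DualExtension ρ :=
  mk (dualRelations ρ) (ofPath K (pathIncl ⟨a, b, p⟩))

/-- The class in `𝒟(Λ)` of the reverse `p*` of a path `p` of `Γ`. -/
def backward {a b : V} (p : Path a b) : DualExtension ρ :=
  mk (dualRelations ρ) (ofPath K (pathStar ⟨a, b, p⟩))

theorem forward_mem_peirceSpace {a b : V} (p : Path a b) :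
    forward ρ p ∈ peirceSpace K (idem (dualRelations ρ)) b a :=
  mk_ofPath_mem_peirceSpace _ _

theorem backward_mem_peirceSpace {a b : V} (p : Path a b) :
    backward ρ p ∈ peirceSpace K (idem (dualRelations ρ)) a b :=
  mk_ofPath_mem_peirceSpace _ _

theorem backward_nil (a : V) : backward ρ (Path.nil : Path a a) = idem (dualRelations ρ) a :=
  rfl

theorem forward_mul_forward {a b c : V} (p : Path b c) (q : Path a b) :
    forward ρ p * forward ρ q = forward ρ (q.comp p) := by
  refine (mk_ofPath_mul_mk_ofPath _ _ _).trans ?_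
  rw [forward, pathIncl, Prefunctor.mapPath_comp]

theorem backward_mul_backward {a b c : V} (p : Path a b) (q : Path b c) :
    backward ρ p * backward ρ q = backward ρ (p.comp q) := by
  refine (mk_ofPath_mul_mk_ofPath _ _ _).trans ?_
  rw [backward, pathStar, Prefunctor.mapPath_comp, Path.reverse_comp]

theorem forward_toPath_mul_backward_toPath {a b c d : V} (α : a ⟶ b) (β : c ⟶ d) :
    forward ρ α.toPath * backward ρ β.toPath = 0 := by
  rw [forward, backward, ← map_mul, mk_eq_zero_iff]
  exact TwoSidedIdeal.subset_span (Or.inr ⟨a, b, c, d, α, β, rfl⟩)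

theorem forward_mul_backward {a b c d : V} {p : Path a b} {q : Path c d} (hp : p.length ≠ 0)
    (hq : q.length ≠ 0) : forward ρ p * backward ρ q = 0 := by
  obtain ⟨_, α, p, rfl, -⟩ := p.length_ne_zero_iff_eq_comp.1 hp
  obtain ⟨_, β, q, rfl, -⟩ := q.length_ne_zero_iff_eq_comp.1 hq
  rw [← forward_mul_forward, ← backward_mul_backward, mul_assoc, ← mul_assoc (forward ρ α.toPath),
    forward_toPath_mul_backward_toPath, zero_mul, mul_zero]

/-- The space spanned by the classes of the folded paths `j → m ← i`, i.e. by the products `q* p`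
of paths `p` from `j` to `m` and `q` from `i` to `m` of `Γ`. -/
def foldedSpan (i j : V) : Submodule K (DualExtension ρ) :=
  Submodule.span K {x | ∃ (m : V) (q : Path i m) (p : Path j m), x = backward ρ q * forward ρ p}

theorem forward_toPath_mul_mem_foldedSpan {i j k : V} (α : i ⟶ k) {x : DualExtension ρ}
    (hx : x ∈ foldedSpan ρ i j) : forward ρ α.toPath * x ∈ foldedSpan ρ k j := by
  have hα : α.toPath.length ≠ 0 := one_ne_zero
  refine mul_mem_of_mem_span ?_ hx
  rintro _ ⟨m, q, p, rfl⟩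
  cases q with
  | nil =>
    refine Submodule.subset_span ⟨k, Path.nil, p.comp α.toPath, ?_⟩
    rw [backward_nil, backward_nil, (forward_mem_peirceSpace ρ p).1,
      (forward_mem_peirceSpace ρ _).1, forward_mul_forward]
  | cons q β =>
    have hqβ : (q.cons β).length ≠ 0 := Nat.succ_ne_zero _
    rw [← mul_assoc, forward_mul_backward ρ hα hqβ, zero_mul]
    exact zero_mem _

theorem backward_mul_mem_foldedSpan {i j k : V} (β : Path k i) {x : DualExtension ρ}
    (hx : x ∈ foldedSpan ρ i j) : backward ρ β * x ∈ foldedSpan ρ k j := by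
  refine mul_mem_of_mem_span ?_ hx
  rintro _ ⟨m, q, p, rfl⟩
  rw [← mul_assoc, backward_mul_backward]
  exact Submodule.subset_span ⟨m, β.comp q, p, rfl⟩

theorem mk_ofPath_mem_foldedSpan {a b : Symmetrify V} (P : Path a b) :
    mk (dualRelations ρ) (ofPath K ⟨a, b, P⟩) ∈ foldedSpan ρ b a := by
  induction P with
  | nil =>
    exact Submodule.subset_span ⟨a, Path.nil, Path.nil,
      ((completeOrthogonalIdempotents_idem (dualRelations ρ)).idem a).eq.symm⟩
  | @cons b c P γ ih =>
    have hcons : mk (dualRelations ρ) (ofPath K ⟨a, c, P.cons γ⟩) =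
        mk (dualRelations ρ) (ofPath K ⟨b, c, γ.toPath⟩) *
          mk (dualRelations ρ) (ofPath K ⟨a, b, P⟩) :=
      (mk_ofPath_mul_mk_ofPath _ γ.toPath P).symm
    rw [hcons]
    rcases γ with α | β
    · exact forward_toPath_mul_mem_foldedSpan ρ α ih
    · exact backward_mul_mem_foldedSpan ρ (Hom.toPath (V := V) β) ih

theorem peirceSpace_le_foldedSpan (i j : V) :
    peirceSpace K (idem (dualRelations ρ)) i j ≤ foldedSpan ρ i j := by
  refine (peirceSpace_le_span _ _ _).trans (Submodule.span_le.2 ?_)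
  rintro _ ⟨P, rfl⟩
  exact mk_ofPath_mem_foldedSpan ρ P

theorem mul_eq_zero_of_isEmpty_path {i j : V} (hij : IsEmpty (Path i j)) {x y : DualExtension ρ}
    (hx : x ∈ peirceSpace K (idem (dualRelations ρ)) i j)
    (hy : y ∈ peirceSpace K (idem (dualRelations ρ)) j i) : x * y = 0 := by
  refine mul_eq_zero_of_mem_span ?_ (peirceSpace_le_foldedSpan ρ i j hx)
    (peirceSpace_le_foldedSpan ρ j i hy)
  rintro _ ⟨m, q, p, rfl⟩ _ ⟨n, q', p', rfl⟩
  have hp : p.length ≠ 0 := fun h => hij.false (p.eq_of_length_zero h ▸ q)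
  have hq' : q'.length ≠ 0 := fun h => hij.false (q'.eq_of_length_zero h ▸ p')
  rw [mul_assoc, ← mul_assoc (forward ρ p), forward_mul_backward ρ hp hq', zero_mul, mul_zero]

theorem isDirectedPeirce (hΓ : HasNoOrientedCycles V) :
    IsDirectedPeirce K (idem (dualRelations ρ)) where
  toCompleteOrthogonalIdempotents := completeOrthogonalIdempotents_idem _
  mul_eq_zero_or i j hij := by
    rcases hΓ.isEmpty_path_or hij with h | h
    · exact Or.inl fun x hx y hy => mul_eq_zero_of_isEmpty_path ρ h hx hy
    · exact Or.inr fun x hx y hy => mul_eq_zero_of_isEmpty_path ρ h hy hx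
  diag_le i := by
    refine (peirceSpace_le_foldedSpan ρ i i).trans (Submodule.span_le.2 ?_)
    rintro _ ⟨m, q, p, rfl⟩
    rcases eq_or_ne m i with rfl | hmi
    · obtain rfl := q.eq_nil_of_length_zero (hΓ _ q)
      obtain rfl := p.eq_nil_of_length_zero (hΓ _ p)
      rw [backward_nil, (forward_mem_peirceSpace ρ _).1]
      exact Submodule.mem_sup_left (Submodule.mem_span_singleton_self _)
    · exact Submodule.mem_sup_right <| Submodule.mem_iSup_of_mem m <|
        Submodule.mem_iSup_of_mem hmi <|
          Submodule.mul_mem_mul (backward_mem_peirceSpace ρ q) (forward_mem_peirceSpace ρ p)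

theorem nontrivialSpan_le_jacobson (hΓ : HasNoOrientedCycles V) :
    nontrivialSpan (dualRelations ρ) ≤
      (Ring.jacobson (DualExtension ρ)).restrictScalars K := by
  refine Submodule.span_le.2 ?_
  rintro _ ⟨⟨a, b, P⟩, hP, rfl⟩
  cases P with
  | nil => exact (Nat.not_succ_le_zero 0 hP).elim
  | @cons c _ P γ =>
    have hcb : b ≠ c := by
      rintro rfl
      rcases γ with α | β
      · exact one_ne_zero (hΓ _ (Hom.toPath (V := V) α))
      · exact one_ne_zero (hΓ _ (Hom.toPath (V := V) β))
    have hγ : mk (dualRelations ρ) (ofPath K ⟨c, b, γ.toPath⟩) ∈ Ring.jacobson (DualExtension ρ) :=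
      (isDirectedPeirce ρ hΓ).peirceSpace_le_jacobson hcb (mk_ofPath_mem_peirceSpace _ _)
    have hcons := mk_ofPath_mul_mk_ofPath (dualRelations ρ) γ.toPath P
    exact hcons ▸ Ideal.mul_mem_right _ _ hγ

theorem toDualExtension_mem_nontrivialSpan {x : BoundPathAlgebra ρ} (hx : x ∈ nontrivialSpan ρ) :
    toDualExtension ρ x ∈ nontrivialSpan (dualRelations ρ) := by
  suffices h : nontrivialSpan ρ ≤
      (nontrivialSpan (dualRelations ρ)).comap (toDualExtension ρ).toLinearMap from h hx
  refine Submodule.span_le.2 ?_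
  rintro _ ⟨p, hp, rfl⟩
  exact Submodule.subset_span ⟨pathIncl p, hp.pathIncl,
    congrArg (mk (dualRelations ρ)) (inclLin_ofPath p)⟩

end DualExtension

end PathAlgebras

theorem corollary4p4_general {K : Type u} [Field K] (hK : ringChar K ≠ 2)
    {V : Type v} [Fintype V] [Quiver.{w + 1} V] (hΓ : HasNoOrientedCycles V)
    (ρ : Set (PathAlgebra K V)) (Θ : DualExtension ρ →ₗ[K] DualExtension ρ)
    (hΘ : IsLieDerivation Θ) :
    ∃ D : DualExtension ρ →ₗ[K] DualExtension ρ, IsAssocDerivation D ∧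
      (∀ x ∈ BoundPathAlgebra.nontrivialSpan ρ,
        Θ (toDualExtension ρ x) = D (toDualExtension ρ x)) ∧
      (∀ y ∈ BoundPathAlgebra.nontrivialSpan (dualRelations ρ), Θ y = D y) := by
  obtain ⟨D, hD, hDJ⟩ := (DualExtension.isDirectedPeirce ρ
    hΓ).exists_isAssocDerivation_eqOn_jacobson (Ring.two_ne_zero hK) hΘ
  have hDy : ∀ y ∈ BoundPathAlgebra.nontrivialSpan (dualRelations ρ), Θ y = D y :=
    fun y hy => hDJ y (DualExtension.nontrivialSpan_le_jacobson ρ hΓ hy)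
  exact ⟨D, hD, fun x hx => hDy _ (DualExtension.toDualExtension_mem_nontrivialSpan ρ hx), hDy⟩

theorem corollary4p4 {K : Type u} [Field K] (hK : ringChar K ≠ 2)
    {V : Type v} [Fintype V] [Quiver.{w + 1} V] [∀ a b : V, Finite (a ⟶ b)]
    (hΓ : HasNoOrientedCycles V)
    (ρ : Set (PathAlgebra K V)) (hρ : ∀ σ ∈ ρ, σ.IsRelation)
    (Θ : DualExtension ρ →ₗ[K] DualExtension ρ) (hΘ : IsLieDerivation Θ) :
    ∃ D : DualExtension ρ →ₗ[K] DualExtension ρ, IsAssocDerivation D ∧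
      (∀ x ∈ BoundPathAlgebra.nontrivialSpan ρ,
        Θ (toDualExtension ρ x) = D (toDualExtension ρ x)) ∧
      (∀ y ∈ BoundPathAlgebra.nontrivialSpan (dualRelations ρ), Θ y = D y) :=
  corollary4p4_general hK hΓ ρ Θ hΘ
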